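/- A \emph{subproduct system} $X$ (of Hilbert spaces, over $\mathbb{N}$) consists of complex Hilbert spaces $X(n)$, $n\in\mathbb{N}$, with $X(0)=\mathbb{C}$, and coisometries $U^X_{m,n}\colon X(m)\otimes X(n)\to X(m+n)$ (Hilbert space tensor products) such that $U^X_{0,n}$ and $U^X_{n,0}$ are scalar multiplication and $U^X_{l+m,n}(U^X_{l,m}\otimes I)=U^X_{l,m+n}(I\otimes U^X_{m,n})$. An \emph{isomorphism} $V\colon X\to Y$ is a family of unitaries $V_n\colon X(n)\to Y(n)$ with $V_0=\mathrm{id}_{\mathbb{C}}$ and $V_{m+n}U^X_{m,n}=U^Y_{m,n}(V_m\otimes V_n)$; it induces the unitary $V=\bigoplus_n V_n\colon \mathfrak{F}_X\to\mathfrak{F}_Y$ between the Fock spaces $\mathfrak{F}_X=\bigoplus_n X(n)$ and $\mathfrak{F}_Y$. Let $\Omega_X=1\in X(0)\subseteq\mathfrak{F}_X$ be the vacuum vector and, for $\xi\in X(m)$, let $S^X(\xi)\in B(\mathfrak{F}_X)$ be given by $S^X(\xi)y=U^X_{m,n}(\xi\otimes y)$ for $y\in X(n)$. Let $\mathcal{A}_X\subseteq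 B(\mathfrak{F}_X)$ be the norm closed unital algebra generated by the operators $S^X(\xi)$, $\xi\in X(1)$ (equivalently, by $S^X(e_i)$ for an orthonormal basis $(e_i)$ of $X(1)$), and let $\rho_0(T)=\langle T\Omega_X,\Omega_X\rangle$ for $T\in\mathcal{A}_X$, so that $\mathcal{A}_X=\mathbb{C}I\oplus\ker\rho_0$. An algebra isomorphism $\varphi\colon\mathcal{A}_X\to\mathcal{A}_Y$ \emph{preserves the direct sum decomposition} if it maps $\mathbb{C}I$ onto $\mathbb{C}I$ and $\ker\rho_0$ onto $\ker\rho_0$; it \emph{preserves the grading} if for all $n$ and all $\xi\in X(n)$ the operator $\varphi(S^X(\xi))$ lies in the norm closure of $\operatorname{span}\{S^Y(\eta):\eta\in Y(n)\}$. \textbf{Theorem.} Let $X$ and $Y$ be subproduct systems of Hilbert spaces over $\mathbb{N}$. The following are equivalent: (i) $X$ and $Y$ are isomorphic; (ii) there is an isometric algebra isomorphism $\mathcal{A}_X\to\mathcal{A}_Y$ that preserves the direct sum decomposition; (iii) there is an isometric algebra isomorphism $\mathcal{A}_X\to\mathcal{A}_Y$ that preserves the grading. Moreover, for every isometric algebra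 isomorphism $\varphi\colon\mathcal{A}_X\to\mathcal{A}_Y$ that preserves the direct sum decomposition or the grading there is an isomorphism $V\colon X\to Y$ such that $\varphi(T)=VTV^*$ for all $T\in\mathcal{A}_X$. -/

import Mathlib

open scoped TensorProduct ENNReal

universe u v

noncomputable section

/-- The Hilbert space tensor product of two complex inner product spaces: the completion of the
algebraic tensor product for the inner product `⟪a ⊗ b, c ⊗ d⟫ = ⟪a, c⟫ * ⟪b, d⟫`. -/
abbrev HTensor (E F : Type*) [NormedAddCommGroup E] [InnerProductSpace ℂ E]
    [NormedAddCommGroup F] [InnerProductSpace ℂ F] : Type _ :=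
  UniformSpace.Completion (E ⊗[ℂ] F)

/-- The elementary tensor `x ⊗ y` in the Hilbert space tensor product. -/
def hTmul {E F : Type*} [NormedAddCommGroup E] [InnerProductSpace ℂ E]
    [NormedAddCommGroup F] [InnerProductSpace ℂ F] (x : E) (y : F) : HTensor E F :=
  ((x ⊗ₜ[ℂ] y : E ⊗[ℂ] F) : UniformSpace.Completion (E ⊗[ℂ] F))

section HTensor

variable {E F : Type*} [NormedAddCommGroup E] [InnerProductSpace ℂ E]
  [NormedAddCommGroup F] [InnerProductSpace ℂ F]

theorem hTmul_add_left (x x' : E) (y : F) : hTmul (x + x') y = hTmul x y + hTmul x' y := by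
  rw [hTmul, TensorProduct.add_tmul, UniformSpace.Completion.coe_add]
  rfl

theorem hTmul_add_right (x : E) (y y' : F) : hTmul x (y + y') = hTmul x y + hTmul x y' := by
  rw [hTmul, TensorProduct.tmul_add, UniformSpace.Completion.coe_add]
  rfl

theorem hTmul_smul_left (c : ℂ) (x : E) (y : F) : hTmul (c • x) y = c • hTmul x y := by
  rw [hTmul, ← TensorProduct.smul_tmul', UniformSpace.Completion.coe_smul]
  rfl

theorem hTmul_smul_right (c : ℂ) (x : E) (y : F) : hTmul x (c • y) = c • hTmul x y := by
  rw [hTmul, TensorProduct.tmul_smul, UniformSpace.Completion.coe_smul]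
  rfl

theorem hTmul_zero (x : E) : hTmul x (0 : F) = 0 := by
  simpa using hTmul_smul_right (0 : ℂ) x (0 : F)

end HTensor

/-- A subproduct system of Hilbert spaces over `ℕ`.

The structure map `U_{m,n} : X(m) ⊗ X(n) → X(m+n)` is `U (rfl : m + n = m + n)`; the index of the
codomain is carried as a separate variable `k` with a proof of `m + n = k` only in order to avoid
transporting along `(l + m) + n = l + (m + n)` in the associativity law. The identification
`X(0) = ℂ` is the unitary `unit`. Identities between bounded operators on Hilbert space tensor
products are stated on elementary tensors, which span a dense subspace. -/
structure SubproductSystem where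
  /-- the fibres `X(n)` -/
  Fiber : ℕ → Type u
  [instNormed : ∀ n, NormedAddCommGroup (Fiber n)]
  [instInner : ∀ n, InnerProductSpace ℂ (Fiber n)]
  [instComplete : ∀ n, CompleteSpace (Fiber n)]
  /-- the identification of `X(0)` with `ℂ` -/
  unit : ℂ ≃ₗᵢ[ℂ] Fiber 0
  /-- the structure maps -/
  U : ∀ {m n k : ℕ}, m + n = k → (HTensor (Fiber m) (Fiber n) →L[ℂ] Fiber k)
  /-- the structure maps are coisometries: `U U* = 1` -/
  coisometric : ∀ {m n k : ℕ} (h : m + n = k),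
    (U h).comp (ContinuousLinearMap.adjoint (U h)) = ContinuousLinearMap.id ℂ (Fiber k)
  /-- `U_{0,n}` is the left action of `ℂ = X(0)` -/
  unit_left : ∀ {n : ℕ} (c : ℂ) (x : Fiber n), U (Nat.zero_add n) (hTmul (unit c) x) = c • x
  /-- `U_{n,0}` is the right action of `ℂ = X(0)` -/
  unit_right : ∀ {n : ℕ} (x : Fiber n) (c : ℂ), U (Nat.add_zero n) (hTmul x (unit c)) = c • x
  /-- `U_{l+m,n} (U_{l,m} ⊗ I) = U_{l,m+n} (I ⊗ U_{m,n})` -/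
  assoc : ∀ {l m n lm mn k : ℕ} (hlm : l + m = lm) (hmn : m + n = mn)
    (hl : lm + n = k) (hr : l + mn = k) (x : Fiber l) (y : Fiber m) (z : Fiber n),
    U hl (hTmul (U hlm (hTmul x y)) z) = U hr (hTmul x (U hmn (hTmul y z)))

attribute [instance] SubproductSystem.instNormed SubproductSystem.instInner
  SubproductSystem.instComplete

namespace SubproductSystem

/-- An isomorphism `V : X → Y` of subproduct systems: unitaries `V_n : X(n) → Y(n)`, with `V_0`
the unital `*`-isomorphism of `ℂ` (that is, the identity of `ℂ`), such that
`V_{m+n} U^X_{m,n} = U^Y_{m,n} (V_m ⊗ V_n)`. -/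
structure Iso (X : SubproductSystem.{u}) (Y : SubproductSystem.{v}) where
  /-- the unitaries on the fibres -/
  map : ∀ n, X.Fiber n ≃ₗᵢ[ℂ] Y.Fiber n
  map_unit : ∀ c : ℂ, map 0 (X.unit c) = Y.unit c
  map_U : ∀ {m n k : ℕ} (h : m + n = k) (x : X.Fiber m) (y : X.Fiber n),
    map k (X.U h (hTmul x y)) = Y.U h (hTmul (map m x) (map n y))

variable (X : SubproductSystem.{u})

theorem norm_U_le {m n k : ℕ} (h : m + n = k) (x : X.Fiber m) (y : X.Fiber n) :
    ‖X.U h (hTmul x y)‖ ≤ ‖x‖ * ‖y‖ := by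
  have h1 : ‖X.U h‖ ≤ 1 := by
    rw [← LinearIsometryEquiv.norm_map (ContinuousLinearMap.adjoint (𝕜 := ℂ)) (X.U h)]
    refine ContinuousLinearMap.opNorm_le_bound _ zero_le_one fun z => ?_
    have h2 : X.U h (ContinuousLinearMap.adjoint (X.U h) z) = z := by
      simpa using congrArg (fun T => T z) (X.coisometric h)
    have h3 : ‖ContinuousLinearMap.adjoint (X.U h) z‖ ^ 2 = ‖z‖ ^ 2 := by
      have := ContinuousLinearMap.apply_norm_sq_eq_inner_adjoint_left
        (ContinuousLinearMap.adjoint (X.U h)) z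
      rw [this, ContinuousLinearMap.adjoint_adjoint]
      simp only [ContinuousLinearMap.coe_comp, Function.comp_apply, h2]
      simpa using (norm_sq_eq_re_inner (𝕜 := ℂ) z).symm
    rw [one_mul]
    exact le_of_sq_le_sq h3.le (norm_nonneg _)
  refine (ContinuousLinearMap.le_of_opNorm_le _ h1 _).trans ?_
  simp [hTmul, UniformSpace.Completion.norm_coe]

/-- The `X`-Fock space `⨁ₙ X(n)` (Hilbert space direct sum). -/
abbrev Fock : Type _ := lp X.Fiber 2

/-- Bounded operators on the Fock space. -/
abbrev FockOp : Type _ := X.Fock →L[ℂ] X.Fock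

/-- The vacuum vector `1 ∈ ℂ = X(0)`. -/
def vacuum : X.Fock := lp.single 2 0 (X.unit 1)

/-- The components of `S^X(x) y` for `x ∈ X(m)`: the `k`-th one is `U_{m,k-m} (x ⊗ y_{k-m})`
if `m ≤ k`, and `0` otherwise. -/
def shiftFun {m : ℕ} (x : X.Fiber m) (y : X.Fock) (k : ℕ) : X.Fiber k :=
  if h : m ≤ k then X.U (Nat.add_sub_cancel' h) (hTmul x (y (k - m))) else 0

theorem shiftFun_bound {m : ℕ} (x : X.Fiber m) (y : X.Fock) :
    Summable (fun k => ‖X.shiftFun x y k‖ ^ 2) ∧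
      ∑' k, ‖X.shiftFun x y k‖ ^ 2 ≤ (‖x‖ * ‖y‖) ^ 2 := by
  have hy : HasSum (fun k => ‖y k‖ ^ 2) (‖y‖ ^ 2) := by
    simpa using lp.hasSum_norm (p := 2) (by norm_num) y
  have hy' := hy.mul_left (‖x‖ ^ 2)
  have hle : ∀ k, ‖X.shiftFun x y (k + m)‖ ^ 2 ≤ ‖x‖ ^ 2 * ‖y k‖ ^ 2 := by
    intro k
    have h1 : ‖X.shiftFun x y (k + m)‖ ≤ ‖x‖ * ‖y (k + m - m)‖ := by
      rw [shiftFun, dif_pos (Nat.le_add_left m k)]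
      exact X.norm_U_le _ _ _
    rw [Nat.add_sub_cancel] at h1
    rw [← mul_pow]
    gcongr
  have hs : Summable (fun k => ‖X.shiftFun x y (k + m)‖ ^ 2) :=
    Summable.of_nonneg_of_le (fun _ => by positivity) hle hy'.summable
  have hs' : Summable (fun k => ‖X.shiftFun x y k‖ ^ 2) := (summable_nat_add_iff m).1 hs
  refine ⟨hs', ?_⟩
  rw [← hs'.sum_add_tsum_nat_add m, Finset.sum_eq_zero, zero_add, mul_pow, ← hy'.tsum_eq]
  · exact hs.tsum_le_tsum hle hy'.summable
  · intro i hi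
    rw [shiftFun, dif_neg (by simpa using hi)]
    simp

theorem shiftFun_memℓp {m : ℕ} (x : X.Fiber m) (y : X.Fock) :
    Memℓp (X.shiftFun x y) 2 := by
  rw [memℓp_gen_iff (by norm_num)]
  simpa using (X.shiftFun_bound x y).1

/-- The `X`-shift representation `S^X : X(m) → B(𝔉_X)`, `S^X(x) y = U_{m,n} (x ⊗ y)` for
`y ∈ X(n)`. -/
def shift (m : ℕ) : X.Fiber m →L[ℂ] X.FockOp :=
  LinearMap.mkContinuous₂
    (LinearMap.mk₂ ℂ (fun x y => (⟨X.shiftFun x y, X.shiftFun_memℓp x y⟩ : X.Fock))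
      (fun x x' y => by
        ext k
        simp only [lp.coeFn_add, Pi.add_apply]
        by_cases h : m ≤ k <;> simp [shiftFun, h, hTmul_add_left])
      (fun c x y => by
        ext k
        simp only [lp.coeFn_smul, Pi.smul_apply]
        by_cases h : m ≤ k <;> simp [shiftFun, h, hTmul_smul_left])
      (fun x y y' => by
        ext k
        simp only [lp.coeFn_add, Pi.add_apply]
        by_cases h : m ≤ k <;> simp [shiftFun, h, hTmul_add_right])
      (fun c x y => by
        ext k
        simp only [lp.coeFn_smul, Pi.smul_apply]
        by_cases h : m ≤ k <;> simp [shiftFun, h, hTmul_smul_right]))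
    1
    (fun x y => by
      rw [one_mul]
      refine lp.norm_le_of_tsum_le (by norm_num) (by positivity) ?_
      simpa using (X.shiftFun_bound x y).2)

theorem shift_single {m n : ℕ} (x : X.Fiber m) (y : X.Fiber n) :
    X.shift m x (lp.single 2 n y) = lp.single 2 (m + n) (X.U rfl (hTmul x y)) := by
  ext k
  change X.shiftFun x (lp.single 2 n y) k = _
  unfold shiftFun
  split_ifs with h
  · obtain ⟨j, rfl⟩ := Nat.exists_eq_add_of_le h
    have key : ∀ (i : ℕ) (hi : m + i = m + j), i = j →
        X.U hi (hTmul x ((lp.single 2 n y : X.Fock) i)) =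
          (lp.single 2 (m + n) (X.U rfl (hTmul x y)) : X.Fock) (m + j) := by
      rintro i hi rfl
      by_cases hin : i = n
      · subst hin
        simp
      · rw [lp.single_apply_ne _ _ _ hin, lp.single_apply_ne _ _ _ (by omega)]
        simp [hTmul_zero]
    exact key _ _ (by omega)
  · rw [lp.single_apply_ne _ _ _ (by omega)]

/-- The algebra `𝒜_X`: the norm closed unital subalgebra of `B(𝔉_X)` generated by the operators
`S^X(x)`, `x ∈ X(1)`. -/
def opAlg : Subalgebra ℂ X.FockOp :=
  (Algebra.adjoin ℂ (Set.range (X.shift 1))).topologicalClosure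

/-- `𝒜_X` is the norm closed unital algebra generated by the standard shift tuple `(S^X(e_i))_i`
of any orthonormal basis `(e_i)_i` of `X(1)`. -/
theorem opAlg_eq_basis {ι : Type*} (e : HilbertBasis ι ℂ (X.Fiber 1)) :
    X.opAlg = (Algebra.adjoin ℂ (Set.range fun i => X.shift 1 (e i))).topologicalClosure := by
  apply le_antisymm
  · refine Subalgebra.topologicalClosure_minimal (Algebra.adjoin_le ?_)
      (Subalgebra.isClosed_topologicalClosure _)
    set B := (Algebra.adjoin ℂ (Set.range fun i => X.shift 1 (e i))).topologicalClosure with hB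
    have hcl : IsClosed ((Subalgebra.toSubmodule B).comap (X.shift 1).toLinearMap :
        Set (X.Fiber 1)) :=
      (Subalgebra.isClosed_topologicalClosure _).preimage (X.shift 1).continuous
    have hsp : Submodule.span ℂ (Set.range e) ≤
        (Subalgebra.toSubmodule B).comap (X.shift 1).toLinearMap := by
      rw [Submodule.span_le]
      rintro _ ⟨i, rfl⟩
      exact Subalgebra.le_topologicalClosure _ (Algebra.subset_adjoin ⟨i, rfl⟩)
    have htop := Submodule.topologicalClosure_minimal _ hsp hcl
    rw [e.dense_span] at htop
    rintro _ ⟨x, rfl⟩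
    exact htop (Submodule.mem_top (x := x))
  · refine Subalgebra.topologicalClosure_mono (Algebra.adjoin_mono ?_)
    rintro _ ⟨i, rfl⟩
    exact ⟨e i, rfl⟩

theorem shift_U {m n k : ℕ} (h : m + n = k) (x : X.Fiber m) (y : X.Fiber n) :
    X.shift k (X.U h (hTmul x y)) = X.shift m x * X.shift n y := by
  ext z j
  change X.shiftFun (X.U h (hTmul x y)) z j = X.shiftFun x (X.shift n y z) j
  by_cases hm : m ≤ j
  · have e1 : X.shiftFun x (X.shift n y z) j =
        X.U (Nat.add_sub_cancel' hm) (hTmul x (X.shiftFun y z (j - m))) := by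
      rw [shiftFun, dif_pos hm]
      rfl
    rw [e1]
    by_cases hk : k ≤ j
    · rw [shiftFun, dif_pos hk, shiftFun, dif_pos (by omega)]
      have key : ∀ (i i' : ℕ) (hi : k + i = j) (hi' : n + i' = j - m), i = i' →
          X.U hi (hTmul (X.U h (hTmul x y)) (z i)) =
            X.U (Nat.add_sub_cancel' hm) (hTmul x (X.U hi' (hTmul y (z i')))) := by
        rintro i _ hi hi' rfl
        exact X.assoc h hi' hi _ x y (z i)
      exact key _ _ _ _ (by omega)
    · rw [shiftFun, dif_neg hk, shiftFun, dif_neg (by omega)]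
      simp [hTmul_zero]
  · rw [shiftFun, dif_neg (by omega), shiftFun, dif_neg hm]

theorem span_U_dense {m n k : ℕ} (h : m + n = k) :
    (Submodule.span ℂ {w | ∃ (x : X.Fiber m) (y : X.Fiber n),
      w = X.U h (hTmul x y)}).topologicalClosure = ⊤ := by
  set S := Submodule.span ℂ {w | ∃ (x : X.Fiber m) (y : X.Fiber n), w = X.U h (hTmul x y)}
  have hcl : IsClosed {t : HTensor (X.Fiber m) (X.Fiber n) | X.U h t ∈ S.topologicalClosure} :=
    S.isClosed_topologicalClosure.preimage (X.U h).continuous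
  have hall : ∀ t : HTensor (X.Fiber m) (X.Fiber n), X.U h t ∈ S.topologicalClosure := by
    intro t
    induction t using UniformSpace.Completion.induction_on with
    | hp => exact hcl
    | ih t =>
      apply S.le_topologicalClosure
      induction t using TensorProduct.induction_on with
      | zero =>
        rw [UniformSpace.Completion.coe_zero, map_zero]
        exact S.zero_mem
      | tmul x y => exact Submodule.subset_span ⟨x, y, rfl⟩
      | add a b ha hb =>
        rw [UniformSpace.Completion.coe_add, map_add]
        exact S.add_mem ha hb
  rw [eq_top_iff]
  intro w _
  have := hall (ContinuousLinearMap.adjoint (X.U h) w)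
  have h2 : X.U h (ContinuousLinearMap.adjoint (X.U h) w) = w := by
    simpa using congrArg (fun T => T w) (X.coisometric h)
  rwa [h2] at this

theorem shift_zero (c : ℂ) : X.shift 0 (X.unit c) = algebraMap ℂ X.FockOp c := by
  ext z k
  change X.shiftFun (X.unit c) z k = c • z k
  rw [shiftFun, dif_pos (Nat.zero_le k)]
  exact X.unit_left c (z k)

/-- The operators `S^X(ξ)`, `ξ ∈ X(n)`, belong to `𝒜_X`. -/
theorem shift_mem_opAlg (n : ℕ) (ξ : X.Fiber n) : X.shift n ξ ∈ X.opAlg := by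
  induction n with
  | zero =>
    obtain ⟨c, rfl⟩ := X.unit.surjective ξ
    rw [shift_zero]
    exact Subalgebra.algebraMap_mem _ c
  | succ n ih =>
    have hcl : IsClosed ((Subalgebra.toSubmodule X.opAlg).comap (X.shift (n + 1)).toLinearMap :
        Set (X.Fiber (n + 1))) :=
      (Subalgebra.isClosed_topologicalClosure _).preimage (X.shift (n + 1)).continuous
    have hsp : Submodule.span ℂ {w | ∃ (x : X.Fiber 1) (y : X.Fiber n),
        w = X.U (Nat.add_comm 1 n) (hTmul x y)} ≤
        (Subalgebra.toSubmodule X.opAlg).comap (X.shift (n + 1)).toLinearMap := by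
      rw [Submodule.span_le]
      rintro _ ⟨x, y, rfl⟩
      change X.shift (n + 1) _ ∈ X.opAlg
      rw [shift_U]
      exact Subalgebra.mul_mem _
        (Subalgebra.le_topologicalClosure _ (Algebra.subset_adjoin ⟨x, rfl⟩)) (ih y)
    have htop := Submodule.topologicalClosure_minimal _ hsp hcl
    rw [span_U_dense] at htop
    exact htop (Submodule.mem_top (x := ξ))

/-- `S^X(ξ)`, `ξ ∈ X(n)`, as an element of `𝒜_X`. -/
def shiftAlg (n : ℕ) (ξ : X.Fiber n) : X.opAlg := ⟨X.shift n ξ, X.shift_mem_opAlg n ξ⟩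

/-- The vacuum state `ρ₀(T) = ⟨T Ω, Ω⟩` on `𝒜_X`, the inner product being linear in the first
variable there and in the second one in Mathlib. -/
def rho0 : X.opAlg →ₗ[ℂ] ℂ :=
  (innerSL ℂ X.vacuum).toLinearMap ∘ₗ
    (ContinuousLinearMap.apply ℂ X.Fock X.vacuum).toLinearMap ∘ₗ X.opAlg.val.toLinearMap

theorem rho0_apply (T : X.opAlg) : X.rho0 T = inner ℂ X.vacuum ((T : X.FockOp) X.vacuum) := rfl

/-- The operators of degree `n`: the norm closure of `span {S^X(ξ) : ξ ∈ X(n)}`. -/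
def homogeneous (n : ℕ) : Submodule ℂ X.FockOp :=
  (Submodule.span ℂ (Set.range (X.shift n))).topologicalClosure

variable {X} {Y : SubproductSystem.{v}}

/-- `φ` preserves the decomposition `𝒜 = ℂ·I ⊕ ker ρ₀`: it carries each of the two summands of
`𝒜_X` onto the corresponding summand of `𝒜_Y`. -/
def PreservesDecomposition (φ : X.opAlg ≃ₐ[ℂ] Y.opAlg) : Prop :=
  (Submodule.span ℂ {(1 : X.opAlg)}).map φ.toLinearMap = Submodule.span ℂ {(1 : Y.opAlg)} ∧
    (LinearMap.ker X.rho0).map φ.toLinearMap = LinearMap.ker Y.rho0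

/-- `φ` preserves the grading: it maps `S^X(ξ)`, `ξ ∈ X(n)`, to an operator of degree `n`. -/
def PreservesGrading (φ : X.opAlg ≃ₐ[ℂ] Y.opAlg) : Prop :=
  ∀ (n : ℕ) (ξ : X.Fiber n), ((φ (X.shiftAlg n ξ) : Y.opAlg) : Y.FockOp) ∈ Y.homogeneous n

namespace Iso

theorem fock_memℓp (V : Iso X Y) (x : X.Fock) : Memℓp (fun n => V.map n (x n)) 2 :=
  (lp.memℓp x).mono' fun _ => (LinearIsometryEquiv.norm_map _ _).le

theorem fock_symm_memℓp (V : Iso X Y) (y : Y.Fock) : Memℓp (fun n => (V.map n).symm (y n)) 2 :=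
  (lp.memℓp y).mono' fun _ => (LinearIsometryEquiv.norm_map _ _).le

/-- The unitary `V = ⨁ₙ V_n : 𝔉_X → 𝔉_Y` induced by an isomorphism of subproduct systems. -/
def fock (V : Iso X Y) : X.Fock ≃ₗᵢ[ℂ] Y.Fock where
  toFun x := ⟨fun n => V.map n (x n), V.fock_memℓp x⟩
  invFun y := ⟨fun n => (V.map n).symm (y n), V.fock_symm_memℓp y⟩
  map_add' x x' := by
    ext n
    exact map_add (V.map n) (x n) (x' n)
  map_smul' c x := by
    ext n
    simp
  left_inv x := by
    ext n
    simp
  right_inv y := by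
    ext n
    simp
  norm_map' x := by
    have h : (0 : ℝ) < (2 : ℝ≥0∞).toReal := by norm_num
    simp [lp.norm_eq_tsum_rpow h]

theorem fock_apply (V : Iso X Y) (x : X.Fock) (n : ℕ) : V.fock x n = V.map n (x n) := rfl

/-- The operator `V T V*` on `𝔉_Y`, for an operator `T` on `𝔉_X`. -/
def conj (V : Iso X Y) (T : X.FockOp) : Y.FockOp :=
  let W : X.Fock →L[ℂ] Y.Fock := V.fock.toContinuousLinearEquiv
  (W.comp T).comp (ContinuousLinearMap.adjoint W)

end Iso

end SubproductSystem

end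

/-! Since `S(ξ)Ω = ξ` and `‖S(ξ)‖ = ‖ξ‖`, the fibre `X(n)` sits isometrically in `𝒜_X` as the space
of degree `n` operators, and `S(x)S(y) = S(U(x ⊗ y))` turns the structure maps into multiplication.
An isometric isomorphism that respects degrees is therefore a family of unitaries intertwining the
structure maps. It equals `T ↦ V T V*`, because both are continuous and agree on the operators
`S(ξ)`, whose span is dense. Conversely, conjugation by the Fock unitary of an isomorphism has all
the required properties.

The real content is that preserving `ker ρ₀` forces degrees to be respected. The coefficient `(TΩ)₁`
vanishes on products of elements of `ker ρ₀` (`coeff_one_mul`), so for `T ∈ ker ρ₀` the degree one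
coefficient of `φ(T)` depends only on that of `T` (`coeff_one_apply`). Let `η` be the degree one
coefficient of `φ(S(ξ))`. The same principle for `φ⁻¹` recovers `ξ` from `φ⁻¹(S(η))`, hence `‖ξ‖ ≤
‖η‖`. But `‖φ(S(ξ))Ω‖ ≤ ‖ξ‖`, so `η` uses up the whole norm and all other coefficients vanish. As an
operator is determined by its coefficients (`eq_zero_of_coeff_eq_zero`), `φ(S(ξ)) = S(η)`
(`apply_shiftAlg_one`). Multiplicativity and density extend this to every degree. -/

namespace SubproductSystem

/-! ### Fourier coefficients of operators in `𝒜_X` -/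

section Coefficients

variable (X : SubproductSystem.{u})

theorem unit_one_norm : ‖X.unit 1‖ = 1 := by simp

theorem norm_vacuum : ‖X.vacuum‖ = 1 := by
  rw [vacuum, lp.norm_single (by norm_num), unit_one_norm]

theorem shift_vacuum {m : ℕ} (ξ : X.Fiber m) :
    X.shift m ξ X.vacuum = lp.single 2 m ξ := by
  rw [vacuum, shift_single]
  have h := X.unit_right ξ 1
  rw [one_smul] at h
  exact congrArg (lp.single 2 m) h

/-- The lower bound is attained at the vacuum, which is sent to `ξ`. -/
theorem norm_shift {m : ℕ} (ξ : X.Fiber m) : ‖X.shift m ξ‖ = ‖ξ‖ := by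
  apply le_antisymm
  · refine ContinuousLinearMap.opNorm_le_bound _ (norm_nonneg _) fun y => ?_
    refine lp.norm_le_of_tsum_le (by norm_num) (by positivity) ?_
    have h := (X.shiftFun_bound ξ y).2
    simp only [ENNReal.toReal_ofNat, Real.rpow_ofNat]
    exact h
  · have h := (X.shift m ξ).le_opNorm X.vacuum
    rwa [shift_vacuum, norm_vacuum, mul_one, lp.norm_single (by norm_num)] at h

theorem norm_shiftAlg {m : ℕ} (ξ : X.Fiber m) : ‖X.shiftAlg m ξ‖ = ‖ξ‖ := X.norm_shift ξ

/-- `shiftAlg` as a linear isometry. -/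
noncomputable def shiftAlgₗᵢ (n : ℕ) : X.Fiber n →ₗᵢ[ℂ] X.opAlg where
  toFun := X.shiftAlg n
  map_add' x y := Subtype.ext (map_add (X.shift n) x y)
  map_smul' c x := Subtype.ext (map_smul (X.shift n) c x)
  norm_map' := X.norm_shiftAlg

@[simp] theorem shiftAlgₗᵢ_apply {n : ℕ} (ξ : X.Fiber n) : X.shiftAlgₗᵢ n ξ = X.shiftAlg n ξ := rfl

theorem shiftAlg_map_zero (n : ℕ) : X.shiftAlg n 0 = 0 := (X.shiftAlgₗᵢ n).map_zero

theorem shiftAlg_injective (n : ℕ) : Function.Injective (X.shiftAlg n) :=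
  (X.shiftAlgₗᵢ n).injective

theorem shiftAlg_U {m n k : ℕ} (h : m + n = k) (x : X.Fiber m) (y : X.Fiber n) :
    X.shiftAlg k (X.U h (hTmul x y)) = X.shiftAlg m x * X.shiftAlg n y :=
  Subtype.ext (X.shift_U h x y)

theorem shiftAlg_unit (c : ℂ) : X.shiftAlg 0 (X.unit c) = algebraMap ℂ X.opAlg c :=
  Subtype.ext (X.shift_zero c)

/-- The span of all the shifts is already a unital subalgebra: `S(x)S(y) = S(U(x ⊗ y))` and `1 =
S(1)` with `1 ∈ X(0)`. -/
theorem opAlg_le_closure_span :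
    (X.opAlg : Set X.FockOp) ⊆
      closure (Submodule.span ℂ {T | ∃ (n : ℕ) (ξ : X.Fiber n), T = X.shift n ξ}) := by
  set S := Submodule.span ℂ {T | ∃ (n : ℕ) (ξ : X.Fiber n), T = X.shift n ξ} with hS
  have h1 : (1 : X.FockOp) ∈ S :=
    Submodule.subset_span ⟨0, X.unit 1, by rw [shift_zero, map_one]⟩
  have hmul : ∀ a b : X.FockOp, a ∈ S → b ∈ S → a * b ∈ S := by
    intro a b ha hb
    have hab := Submodule.mul_mem_mul ha hb
    rw [hS, Submodule.span_mul_span] at hab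
    refine Submodule.span_mono ?_ hab
    rintro _ ⟨_, ⟨m, x, rfl⟩, _, ⟨n, y, rfl⟩, rfl⟩
    exact ⟨m + n, X.U rfl (hTmul x y), (X.shift_U rfl x y).symm⟩
  have hle : Algebra.adjoin ℂ (Set.range (X.shift 1)) ≤ S.toSubalgebra h1 hmul := by
    refine Algebra.adjoin_le ?_
    rintro _ ⟨x, rfl⟩
    exact Submodule.subset_span ⟨1, x, rfl⟩
  exact closure_mono hle

/-- A closed subspace of `𝒜_X` that contains all the operators `S^X(ξ)` is everything. -/
theorem eq_top_of_shiftAlg_mem {S : Submodule ℂ X.opAlg} (hc : IsClosed (S : Set X.opAlg))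
    (hS : ∀ (n : ℕ) (ξ : X.Fiber n), X.shiftAlg n ξ ∈ S) : S = ⊤ := by
  rw [eq_top_iff]
  intro T _
  have hsp : Submodule.span ℂ {T | ∃ (n : ℕ) (ξ : X.Fiber n), T = X.shiftAlg n ξ} ≤ S := by
    rw [Submodule.span_le]
    rintro _ ⟨n, ξ, rfl⟩
    exact hS n ξ
  refine closure_minimal (SetLike.coe_subset_coe.2 hsp) hc ?_
  rw [closure_subtype]
  refine closure_mono ?_ (X.opAlg_le_closure_span T.2)
  have himg : Submodule.span ℂ {T | ∃ (n : ℕ) (ξ : X.Fiber n), T = X.shift n ξ} ≤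
      (Submodule.span ℂ {T | ∃ (n : ℕ) (ξ : X.Fiber n), T = X.shiftAlg n ξ}).map
        X.opAlg.val.toLinearMap := by
    rw [Submodule.span_le]
    rintro _ ⟨n, ξ, rfl⟩
    exact ⟨X.shiftAlg n ξ, Submodule.subset_span ⟨n, ξ, rfl⟩, rfl⟩
  exact himg

theorem continuousLinearMap_ext_shiftAlg {W : Type*} [NormedAddCommGroup W] [NormedSpace ℂ W]
    {f g : X.opAlg →L[ℂ] W}
    (h : ∀ (n : ℕ) (ξ : X.Fiber n), f (X.shiftAlg n ξ) = g (X.shiftAlg n ξ)) : f = g := by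
  have htop := X.eq_top_of_shiftAlg_mem (S := LinearMap.eqLocus (f : X.opAlg →ₗ[ℂ] W) g)
    (isClosed_eq f.continuous g.continuous) h
  ext T
  exact htop.ge (Submodule.mem_top (x := T))

/-- The inclusion of `𝒜_X` in `B(𝔉_X)`. -/
noncomputable def opAlgIncl : X.opAlg →L[ℂ] X.FockOp :=
  (Subalgebra.toSubmodule X.opAlg).subtypeL

/-- The matrix entry `T ↦ (T y)_k` on `𝒜_X`. -/
noncomputable def entry (y : X.Fock) (k : ℕ) : X.opAlg →L[ℂ] X.Fiber k :=
  (lp.evalCLM ℂ X.Fiber 2 k).comp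
    ((ContinuousLinearMap.apply ℂ X.Fock y).comp X.opAlgIncl)

/-- The Fourier coefficient `(T Ω)_n` of `T`. -/
noncomputable def coeff (n : ℕ) : X.opAlg →L[ℂ] X.Fiber n := X.entry X.vacuum n

theorem coeff_apply (n : ℕ) (T : X.opAlg) : X.coeff n T = (T : X.FockOp) X.vacuum n := rfl

@[simp] theorem coeff_shiftAlg_self {n : ℕ} (ξ : X.Fiber n) : X.coeff n (X.shiftAlg n ξ) = ξ := by
  change X.shift n ξ X.vacuum n = ξ
  rw [shift_vacuum, lp.single_apply_self]

theorem coeff_shiftAlg_ne {k n : ℕ} (h : k ≠ n) (ξ : X.Fiber n) :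
    X.coeff k (X.shiftAlg n ξ) = 0 := by
  change X.shift n ξ X.vacuum k = 0
  rw [shift_vacuum, lp.single_apply_ne _ _ _ h]

/-- The coefficients are the orthogonal components of `TΩ`, and `‖TΩ‖ ≤ ‖T‖`. Two of them suffice to
conclude that once one coefficient has norm `‖T‖`, every other one is zero. -/
theorem norm_coeff_sq_add_le {m n : ℕ} (h : m ≠ n) (T : X.opAlg) :
    ‖X.coeff m T‖ ^ 2 + ‖X.coeff n T‖ ^ 2 ≤ ‖T‖ ^ 2 := by
  have h1 : ‖(T : X.FockOp) X.vacuum‖ ≤ ‖T‖ := by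
    have := (T : X.FockOp).le_opNorm X.vacuum
    rwa [norm_vacuum, mul_one] at this
  have h2 := lp.sum_rpow_le_norm_rpow (p := 2) (by norm_num) ((T : X.FockOp) X.vacuum) {m, n}
  rw [Finset.sum_pair h] at h2
  simp only [ENNReal.toReal_ofNat, Real.rpow_ofNat] at h2
  exact h2.trans (by gcongr)

theorem norm_coeff_le (n : ℕ) (T : X.opAlg) : ‖X.coeff n T‖ ≤ ‖T‖ := by
  have h := X.norm_coeff_sq_add_le (Nat.succ_ne_self n) T
  exact le_of_sq_le_sq (by nlinarith [sq_nonneg ‖X.coeff (n + 1) T‖]) (norm_nonneg _)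

/-- Only the degree `m` part of `T` can carry `X(n)` to `X(m + n)`. By continuity this is tested on
`S(ξ)`, `ξ ∈ X(k)`, which raises degrees by exactly `k`. -/
theorem entry_single_add {n : ℕ} (y : X.Fiber n) (m : ℕ) (T : X.opAlg) :
    X.entry (lp.single 2 n y) (m + n) T =
      X.entry (lp.single 2 n y) (m + n) (X.shiftAlg m (X.coeff m T)) := by
  have h : X.entry (lp.single 2 n y) (m + n) = (X.entry (lp.single 2 n y) (m + n)).comp
      ((X.shiftAlgₗᵢ m).toContinuousLinearMap.comp (X.coeff m)) := by
    refine X.continuousLinearMap_ext_shiftAlg fun k ξ => ?_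
    by_cases hk : m = k
    · subst hk
      simp
    · have hz : X.coeff m (X.shiftAlg k ξ) = 0 := X.coeff_shiftAlg_ne hk ξ
      simp only [ContinuousLinearMap.comp_apply, hz, map_zero]
      change X.shift k ξ (lp.single 2 n y) (m + n) = 0
      rw [shift_single, lp.single_apply_ne _ _ _ (by omega)]
  exact congrArg (fun f => f T) h

theorem entry_single_of_lt {n k : ℕ} (hk : k < n) (y : X.Fiber n) (T : X.opAlg) :
    X.entry (lp.single 2 n y) k T = 0 := by
  have h : X.entry (lp.single 2 n y) k = 0 := by
    refine X.continuousLinearMap_ext_shiftAlg fun m ξ => ?_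
    change X.shift m ξ (lp.single 2 n y) k = 0
    rw [shift_single, lp.single_apply_ne _ _ _ (by omega)]
  rw [h]
  rfl

/-- An operator in `𝒜_X` is determined by its Fourier coefficients. -/
theorem eq_zero_of_coeff_eq_zero {T : X.opAlg} (h : ∀ n, X.coeff n T = 0) : T = 0 := by
  -- On `X(n)`, the entries of `T` below degree `n` vanish and those in degree `m + n` depend only
  -- on the `m`-th coefficient.
  have hs : ∀ (n : ℕ) (y : X.Fiber n), (T : X.FockOp) (lp.single 2 n y) = 0 := by
    intro n y
    ext k
    change X.entry (lp.single 2 n y) k T = 0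
    rcases lt_or_ge k n with hk | hk
    · exact X.entry_single_of_lt hk y T
    · obtain ⟨m, rfl⟩ := Nat.exists_eq_add_of_le' hk
      rw [entry_single_add, h, shiftAlg_map_zero, map_zero]
  refine Subtype.ext (ContinuousLinearMap.ext fun y => ?_)
  have hy := (lp.hasSum_single (by norm_num) y).mapL (T : X.FockOp)
  simp only [hs] at hy
  exact hy.unique hasSum_zero

/-- If all but one of the Fourier coefficients vanish then the operator is homogeneous. -/
theorem eq_shiftAlg_of_coeff {T : X.opAlg} {n : ℕ} (h : ∀ k, k ≠ n → X.coeff k T = 0) :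
    T = X.shiftAlg n (X.coeff n T) := by
  rw [← sub_eq_zero]
  refine X.eq_zero_of_coeff_eq_zero fun k => ?_
  by_cases hk : k = n
  · subst hk
    simp
  · rw [map_sub, h k hk, coeff_shiftAlg_ne _ hk, sub_zero]

/-- `X(0)` is spanned by the vacuum, so pairing with the vacuum loses nothing. -/
theorem rho0_eq_zero_iff (T : X.opAlg) : X.rho0 T = 0 ↔ X.coeff 0 T = 0 := by
  rw [rho0_apply, vacuum, lp.inner_single_left, ← vacuum, ← coeff_apply]
  constructor
  · intro h
    obtain ⟨c, hc⟩ := X.unit.surjective (X.coeff 0 T)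
    rw [← hc, LinearIsometryEquiv.inner_map_map] at h
    rw [← hc, show c = 0 by simpa using h, map_zero]
  · intro h
    rw [h, inner_zero_right]

end Coefficients

end SubproductSystem
namespace SubproductSystem

/-! ### Isometric isomorphisms preserve the operators of each degree -/

section Homogeneous

variable (X : SubproductSystem.{u})

/-- A continuous linear map that vanishes on products of elements of `ker ρ₀` only depends on the
Fourier coefficients of degree `0` and `1`. -/
theorem apply_eq_of_vanish_mul {W : Type*} [NormedAddCommGroup W] [NormedSpace ℂ W]
    (f : X.opAlg →L[ℂ] W)
    (hf : ∀ a b, X.coeff 0 a = 0 → X.coeff 0 b = 0 → f (a * b) = 0) (T : X.opAlg) :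
    f T = f (X.shiftAlg 0 (X.coeff 0 T)) + f (X.shiftAlg 1 (X.coeff 1 T)) := by
  have h : f = f.comp ((X.shiftAlgₗᵢ 0).toContinuousLinearMap.comp (X.coeff 0)) +
      f.comp ((X.shiftAlgₗᵢ 1).toContinuousLinearMap.comp (X.coeff 1)) := by
    refine X.continuousLinearMap_ext_shiftAlg fun n ξ => ?_
    simp only [add_apply, ContinuousLinearMap.comp_apply]
    match n with
    | 0 => simp [X.coeff_shiftAlg_ne one_ne_zero ξ, shiftAlg_map_zero]
    | 1 => simp [X.coeff_shiftAlg_ne zero_ne_one ξ, shiftAlg_map_zero]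
    -- Products of `X(1)` and `X(n + 1)` span a dense subspace of `X(n + 2)`, and both factors have
    -- positive degree, so `f` kills all operators of degree `n + 2`.
    | n + 2 =>
      rw [X.coeff_shiftAlg_ne (by omega), X.coeff_shiftAlg_ne (by omega), map_zero, map_zero,
        map_zero, map_zero, add_zero]
      set g : X.Fiber (n + 2) →L[ℂ] W := f.comp (X.shiftAlgₗᵢ (n + 2)).toContinuousLinearMap
      have hsp : Submodule.span ℂ {w | ∃ (x : X.Fiber 1) (y : X.Fiber (n + 1)),
          w = X.U (Nat.add_comm 1 (n + 1)) (hTmul x y)} ≤ LinearMap.ker g.toLinearMap := by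
        rw [Submodule.span_le]
        rintro _ ⟨x, y, rfl⟩
        change f (X.shiftAlg (n + 2) _) = 0
        rw [shiftAlg_U]
        exact hf _ _ (X.coeff_shiftAlg_ne (by omega) _) (X.coeff_shiftAlg_ne (by omega) _)
      have htop := Submodule.topologicalClosure_minimal _ hsp g.isClosed_ker
      rw [span_U_dense] at htop
      exact htop (Submodule.mem_top (x := ξ))
  exact congrArg (fun g => g T) h

/-- With `y = bΩ` fixed, the degree one component of `a y` is continuous and linear in `a`. As `y`
starts in degree one, a shift of positive degree moves it beyond degree one, so only the degree zero
part of `a` contributes, and that part is zero. -/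
theorem coeff_one_mul {a b : X.opAlg} (ha : X.coeff 0 a = 0) (hb : X.coeff 0 b = 0) :
    X.coeff 1 (a * b) = 0 := by
  set y := (b : X.FockOp) X.vacuum with hy
  have hy0 : y 0 = 0 := hb
  have h : X.entry y 1 =
      (X.entry y 1).comp ((X.shiftAlgₗᵢ 0).toContinuousLinearMap.comp (X.coeff 0)) := by
    refine X.continuousLinearMap_ext_shiftAlg fun n ξ => ?_
    match n with
    | 0 => simp
    | n + 1 =>
      simp only [ContinuousLinearMap.comp_apply]
      rw [X.coeff_shiftAlg_ne (by omega), map_zero, map_zero]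
      change X.shiftFun ξ y 1 = 0
      rw [shiftFun]
      split_ifs with hn
      -- The index that occurs is `1 - (n + 1)`; the type of `y i` depends on `i`, so the equality
      -- with `0` is substituted for a variable index.
      · have hz : ∀ i, i = 0 → y i = 0 := by
          rintro _ rfl
          exact hy0
        rw [hz _ (by omega), hTmul_zero, map_zero]
      · rfl
  have h' := congrArg (fun g => g a) h
  simp only [ContinuousLinearMap.comp_apply, ha, map_zero] at h'
  exact h'

variable {X} {Y : SubproductSystem.{v}}

/-- An isometric isomorphism of the operator algebras as a continuous linear map. -/
noncomputable def toCLM (φ : X.opAlg ≃ₐ[ℂ] Y.opAlg) (hφ : Isometry φ) : X.opAlg →L[ℂ] Y.opAlg :=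
  ⟨φ.toLinearMap, hφ.continuous⟩

theorem isometry_symm {φ : X.opAlg ≃ₐ[ℂ] Y.opAlg} (hφ : Isometry φ) : Isometry φ.symm :=
  hφ.right_inv φ.right_inv

theorem norm_apply_of_isometry {φ : X.opAlg ≃ₐ[ℂ] Y.opAlg} (hφ : Isometry φ) (T : X.opAlg) :
    ‖φ T‖ = ‖T‖ :=
  hφ.norm_map_of_map_zero (map_zero φ) T

/-- `apply_eq_of_vanish_mul` applies to `T ↦ (φ(T)Ω)₁`, because `φ` carries products from `ker ρ₀`
to products from `ker ρ₀`. -/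
theorem coeff_one_apply {φ : X.opAlg ≃ₐ[ℂ] Y.opAlg} (hφ : Isometry φ)
    (h0 : ∀ T, X.coeff 0 T = 0 → Y.coeff 0 (φ T) = 0) {T : X.opAlg} (hT : X.coeff 0 T = 0) :
    Y.coeff 1 (φ T) = Y.coeff 1 (φ (X.shiftAlg 1 (X.coeff 1 T))) := by
  have h := X.apply_eq_of_vanish_mul ((Y.coeff 1).comp (toCLM φ hφ)) (fun a b ha hb => by
    change Y.coeff 1 (φ (a * b)) = 0
    rw [map_mul]
    exact Y.coeff_one_mul (h0 a ha) (h0 b hb)) T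
  rw [hT, shiftAlg_map_zero, map_zero, zero_add] at h
  exact h

/-- An isometric isomorphism that preserves `ker ρ₀` preserves the operators of degree one. -/
theorem apply_shiftAlg_one {φ : X.opAlg ≃ₐ[ℂ] Y.opAlg} (hφ : Isometry φ)
    (h0 : ∀ T, X.coeff 0 T = 0 ↔ Y.coeff 0 (φ T) = 0) (ξ : X.Fiber 1) :
    φ (X.shiftAlg 1 ξ) = Y.shiftAlg 1 (Y.coeff 1 (φ (X.shiftAlg 1 ξ))) := by
  have hnorm : ‖φ (X.shiftAlg 1 ξ)‖ = ‖ξ‖ := by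
    rw [norm_apply_of_isometry hφ, norm_shiftAlg]
  have hξ : Y.coeff 0 (φ (X.shiftAlg 1 ξ)) = 0 :=
    (h0 _).1 (X.coeff_shiftAlg_ne zero_ne_one ξ)
  -- With `η` the degree one coefficient of `φ(S(ξ))`, the inverse gives `ξ` as the degree one
  -- coefficient of `φ⁻¹(S(η))`, hence `‖ξ‖ ≤ ‖η‖`.
  have hback := coeff_one_apply (isometry_symm hφ)
    (fun T hT => (h0 _).2 (by rwa [AlgEquiv.apply_symm_apply])) hξ
  rw [AlgEquiv.symm_apply_apply, coeff_shiftAlg_self] at hback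
  have hle : ‖ξ‖ ≤ ‖Y.coeff 1 (φ (X.shiftAlg 1 ξ))‖ := by
    conv_lhs => rw [hback]
    refine (X.norm_coeff_le 1 _).trans ?_
    rw [norm_apply_of_isometry (isometry_symm hφ), norm_shiftAlg]
  refine Y.eq_shiftAlg_of_coeff fun k hk => ?_
  have hsum := Y.norm_coeff_sq_add_le hk (φ (X.shiftAlg 1 ξ))
  rw [hnorm] at hsum
  have hsq : ‖ξ‖ ^ 2 ≤ ‖Y.coeff 1 (φ (X.shiftAlg 1 ξ))‖ ^ 2 := by gcongr
  have hk0 : ‖Y.coeff k (φ (X.shiftAlg 1 ξ))‖ ^ 2 = 0 :=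
    le_antisymm (by linarith) (sq_nonneg _)
  exact norm_eq_zero.1 (pow_eq_zero_iff two_ne_zero |>.1 hk0)

theorem isClosed_range_shiftAlg (X : SubproductSystem.{u}) (n : ℕ) :
    IsClosed (Set.range (X.shiftAlgₗᵢ n)) :=
  (X.shiftAlgₗᵢ n).isometry.isClosedEmbedding.isClosed_range

/-- A continuous isomorphism that preserves the operators of degree one preserves the operators of
every degree. -/
theorem apply_shiftAlg_mem_range {φ : X.opAlg ≃ₐ[ℂ] Y.opAlg} (hφ : Isometry φ)
    (h1 : ∀ ξ : X.Fiber 1, φ (X.shiftAlg 1 ξ) ∈ Set.range (Y.shiftAlg 1)) (n : ℕ)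
    (ξ : X.Fiber n) : φ (X.shiftAlg n ξ) ∈ Set.range (Y.shiftAlg n) := by
  induction n with
  | zero =>
    obtain ⟨c, rfl⟩ := X.unit.surjective ξ
    exact ⟨Y.unit c, by rw [shiftAlg_unit, shiftAlg_unit, AlgEquiv.commutes]⟩
  | succ n ih =>
    set g : X.Fiber (n + 1) →L[ℂ] Y.opAlg :=
      (toCLM φ hφ).comp (X.shiftAlgₗᵢ (n + 1)).toContinuousLinearMap with hg
    -- The vectors with the desired property form a closed subspace, so products of `X(1)` and
    -- `X(n)` are enough.
    set R := (LinearMap.range (Y.shiftAlgₗᵢ (n + 1)).toLinearMap).comap g.toLinearMap with hR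
    have hcl : IsClosed (R : Set (X.Fiber (n + 1))) :=
      (Y.isClosed_range_shiftAlg (n + 1)).preimage g.continuous
    have hsp : Submodule.span ℂ {w | ∃ (x : X.Fiber 1) (y : X.Fiber n),
        w = X.U (Nat.add_comm 1 n) (hTmul x y)} ≤ R := by
      rw [Submodule.span_le]
      rintro _ ⟨x, y, rfl⟩
      obtain ⟨x', hx⟩ := h1 x
      obtain ⟨y', hy⟩ := ih y
      refine ⟨Y.U (Nat.add_comm 1 n) (hTmul x' y'), ?_⟩
      change Y.shiftAlg (n + 1) _ = φ (X.shiftAlg (n + 1) _)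
      rw [shiftAlg_U, shiftAlg_U, map_mul, hx, hy]
    have htop := Submodule.topologicalClosure_minimal _ hsp hcl
    rw [span_U_dense] at htop
    exact htop (Submodule.mem_top (x := ξ))

theorem PreservesDecomposition.apply_shiftAlg_mem_range {φ : X.opAlg ≃ₐ[ℂ] Y.opAlg}
    (h : PreservesDecomposition φ) (hφ : Isometry φ) (n : ℕ) (ξ : X.Fiber n) :
    φ (X.shiftAlg n ξ) ∈ Set.range (Y.shiftAlg n) := by
  have h0 : ∀ T, X.coeff 0 T = 0 ↔ Y.coeff 0 (φ T) = 0 := by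
    intro T
    rw [← rho0_eq_zero_iff, ← rho0_eq_zero_iff, ← LinearMap.mem_ker, ← LinearMap.mem_ker, ← h.2]
    -- Both directions are needed, since the degree one argument also runs through `φ⁻¹`.
    exact ⟨fun hT => ⟨T, hT, rfl⟩, fun ⟨T', hT', e⟩ => φ.injective e ▸ hT'⟩
  exact SubproductSystem.apply_shiftAlg_mem_range hφ
    (fun ξ => ⟨_, (apply_shiftAlg_one hφ h0 ξ).symm⟩) n ξ

/-- `S` is linear and isometric on a complete space, so its range is already a closed subspace. -/
theorem homogeneous_eq_range (X : SubproductSystem.{u}) (n : ℕ) :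
    (X.homogeneous n : Set X.FockOp) = Set.range (X.shift n) := by
  have hiso : Isometry (X.shift n) :=
    AddMonoidHomClass.isometry_of_norm (X.shift n) fun ξ => X.norm_shift ξ
  have hr : Set.range (X.shift n) = (LinearMap.range (X.shift n).toLinearMap : Set X.FockOp) := rfl
  rw [homogeneous, Submodule.topologicalClosure_coe, hr, Submodule.span_eq, ← hr]
  exact hiso.isClosedEmbedding.isClosed_range.closure_eq

theorem PreservesGrading.apply_shiftAlg_mem_range {φ : X.opAlg ≃ₐ[ℂ] Y.opAlg}
    (h : PreservesGrading φ) (n : ℕ) (ξ : X.Fiber n) :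
    φ (X.shiftAlg n ξ) ∈ Set.range (Y.shiftAlg n) := by
  have hm : ((φ (X.shiftAlg n ξ) : Y.opAlg) : Y.FockOp) ∈ (Y.homogeneous n : Set Y.FockOp) := h n ξ
  rw [homogeneous_eq_range] at hm
  obtain ⟨η, hη⟩ := hm
  exact ⟨η, Subtype.ext hη⟩

end Homogeneous

end SubproductSystem
namespace SubproductSystem

/-! ### From isomorphisms of algebras to isomorphisms of subproduct systems, and back -/

section Implementation

variable {X : SubproductSystem.{u}} {Y : SubproductSystem.{v}}

/-- The action of an isometric isomorphism on the operators of degree `n`. -/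
noncomputable def fiberMap (φ : X.opAlg ≃ₐ[ℂ] Y.opAlg) (hφ : Isometry φ)
    (h : ∀ n ξ, φ (X.shiftAlg n ξ) ∈ Set.range (Y.shiftAlg n)) (n : ℕ) :
    X.Fiber n →ₗᵢ[ℂ] Y.Fiber n where
  toLinearMap := (Y.coeff n).toLinearMap ∘ₗ φ.toLinearMap ∘ₗ (X.shiftAlgₗᵢ n).toLinearMap
  norm_map' ξ := by
    change ‖Y.coeff n (φ (X.shiftAlg n ξ))‖ = ‖ξ‖
    obtain ⟨η, hη⟩ := h n ξ
    rw [← hη, coeff_shiftAlg_self, ← norm_shiftAlg, hη,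
      norm_apply_of_isometry hφ, norm_shiftAlg]

variable {φ : X.opAlg ≃ₐ[ℂ] Y.opAlg}

theorem shiftAlg_fiberMap (hφ : Isometry φ)
    (h : ∀ n ξ, φ (X.shiftAlg n ξ) ∈ Set.range (Y.shiftAlg n)) (n : ℕ) (ξ : X.Fiber n) :
    Y.shiftAlg n (fiberMap φ hφ h n ξ) = φ (X.shiftAlg n ξ) := by
  obtain ⟨η, hη⟩ := h n ξ
  change Y.shiftAlg n (Y.coeff n (φ (X.shiftAlg n ξ))) = _
  rw [← hη, coeff_shiftAlg_self]

/-- It is not assumed that `φ⁻¹` respects degrees. Instead, `T ↦ (φ(T)Ω)ₙ` takes values in the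
closed range of `fiberMap` when `T` is a shift, hence for all `T`, and `T = φ⁻¹(S(η))` produces `η`.
-/
theorem fiberMap_surjective (hφ : Isometry φ)
    (h : ∀ n ξ, φ (X.shiftAlg n ξ) ∈ Set.range (Y.shiftAlg n)) (n : ℕ) :
    Function.Surjective (fiberMap φ hφ h n) := by
  set g : X.opAlg →L[ℂ] Y.Fiber n := (Y.coeff n).comp (toCLM φ hφ)
  set R := (LinearMap.range (fiberMap φ hφ h n).toLinearMap).comap g.toLinearMap
  have hcl : IsClosed (R : Set X.opAlg) :=
    (fiberMap φ hφ h n).isometry.isClosedEmbedding.isClosed_range.preimage g.continuous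
  have htop : R = ⊤ := by
    refine X.eq_top_of_shiftAlg_mem hcl fun k ξ => ?_
    by_cases hk : n = k
    · subst hk
      exact ⟨ξ, rfl⟩
    · have hz : g (X.shiftAlg k ξ) = 0 := by
        change Y.coeff n (φ (X.shiftAlg k ξ)) = 0
        rw [← shiftAlg_fiberMap hφ h, coeff_shiftAlg_ne _ hk]
      exact ⟨0, by simpa using hz.symm⟩
  intro η
  obtain ⟨ξ, hξ⟩ := htop.ge (Submodule.mem_top (x := φ.symm (Y.shiftAlg n η)))
  refine ⟨ξ, hξ.trans ?_⟩
  change Y.coeff n (φ (φ.symm (Y.shiftAlg n η))) = η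
  rw [AlgEquiv.apply_symm_apply, coeff_shiftAlg_self]

/-- The isomorphism of subproduct systems given by a grading preserving isometric isomorphism. -/
noncomputable def isoOfAlgEquiv (φ : X.opAlg ≃ₐ[ℂ] Y.opAlg) (hφ : Isometry φ)
    (h : ∀ n ξ, φ (X.shiftAlg n ξ) ∈ Set.range (Y.shiftAlg n)) : Iso X Y where
  map n := LinearIsometryEquiv.ofSurjective (fiberMap φ hφ h n) (fiberMap_surjective hφ h n)
  -- After applying the injective map `S`, the two axioms say that `φ` fixes scalars and is
  -- multiplicative.
  map_unit c := Y.shiftAlg_injective 0 <| by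
    change Y.shiftAlg 0 (fiberMap φ hφ h 0 _) = _
    rw [shiftAlg_fiberMap, shiftAlg_unit, shiftAlg_unit, AlgEquiv.commutes]
  map_U {m n k} hk x y := Y.shiftAlg_injective k <| by
    change Y.shiftAlg k (fiberMap φ hφ h k _) =
      Y.shiftAlg k (Y.U hk (hTmul (fiberMap φ hφ h m x) (fiberMap φ hφ h n y)))
    rw [shiftAlg_fiberMap, shiftAlg_U, shiftAlg_U, shiftAlg_fiberMap, shiftAlg_fiberMap, map_mul]

/-! ### Conjugation by the Fock space unitary -/

namespace Iso

/-- The map `T ↦ V T V*` as an isomorphism of algebras. -/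
noncomputable def fockConj (V : Iso X Y) : X.FockOp ≃ₐ[ℂ] Y.FockOp :=
  V.fock.toContinuousLinearEquiv.conjContinuousAlgEquiv.toAlgEquiv

theorem conj_eq_fockConj (V : Iso X Y) (T : X.FockOp) :
    V.conj T = V.fockConj T := by
  rw [conj]
  have hadj : ContinuousLinearMap.adjoint (V.fock.toContinuousLinearEquiv : X.Fock →L[ℂ] Y.Fock) =
      (V.fock.symm.toContinuousLinearEquiv : Y.Fock →L[ℂ] X.Fock) :=
    LinearIsometryEquiv.adjoint_eq_symm V.fock
  simp only [hadj]
  rfl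

theorem fock_shift (V : Iso X Y) {m : ℕ} (ξ : X.Fiber m) (x : X.Fock) :
    V.fock (X.shift m ξ x) = Y.shift m (V.map m ξ) (V.fock x) := by
  ext k
  change V.map k (X.shiftFun ξ x k) = Y.shiftFun (V.map m ξ) (V.fock x) k
  rw [shiftFun, shiftFun]
  split_ifs with hk
  · rw [V.map_U, fock_apply]
  · exact map_zero _

theorem conj_shift (V : Iso X Y) {m : ℕ} (ξ : X.Fiber m) :
    V.conj (X.shift m ξ) = Y.shift m (V.map m ξ) := by
  rw [conj_eq_fockConj]
  ext1 y
  change V.fock (X.shift m ξ (V.fock.symm y)) = _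
  rw [fock_shift, LinearIsometryEquiv.apply_symm_apply]

/-- The inverse of an isomorphism of subproduct systems. -/
def symm (V : Iso X Y) : Iso Y X where
  map n := (V.map n).symm
  map_unit c := by rw [LinearIsometryEquiv.symm_apply_eq, V.map_unit]
  map_U hk x y := by
    rw [LinearIsometryEquiv.symm_apply_eq, V.map_U, LinearIsometryEquiv.apply_symm_apply,
      LinearIsometryEquiv.apply_symm_apply]

theorem norm_fockConj_le (V : Iso X Y) (T : X.FockOp) : ‖V.fockConj T‖ ≤ ‖T‖ := by
  refine ContinuousLinearMap.opNorm_le_bound _ (norm_nonneg _) fun y => ?_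
  change ‖V.fock (T (V.fock.symm y))‖ ≤ _
  rw [LinearIsometryEquiv.norm_map, ← V.fock.symm.norm_map y]
  exact T.le_opNorm _

theorem fockConj_symm_fockConj (V : Iso X Y) (T : X.FockOp) :
    V.symm.fockConj (V.fockConj T) = T := by
  ext1 x
  exact (V.fock.symm_apply_apply _).trans (congrArg T (V.fock.symm_apply_apply x))

theorem fockConj_fockConj_symm (V : Iso X Y) (T : Y.FockOp) :
    V.fockConj (V.symm.fockConj T) = T := V.symm.fockConj_symm_fockConj T

theorem norm_fockConj (V : Iso X Y) (T : X.FockOp) : ‖V.fockConj T‖ = ‖T‖ := by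
  refine le_antisymm (V.norm_fockConj_le T) ?_
  conv_lhs => rw [← V.fockConj_symm_fockConj T]
  exact V.symm.norm_fockConj_le _

theorem isometry_fockConj (V : Iso X Y) : Isometry V.fockConj :=
  AddMonoidHomClass.isometry_of_norm V.fockConj V.norm_fockConj

/-- Conjugation is continuous, `𝒜_Y` is closed, and `S(ξ)` goes to `S(Vξ)`. -/
theorem conj_mem_opAlg (V : Iso X Y) (T : X.opAlg) : V.conj T ∈ Y.opAlg := by
  rw [conj_eq_fockConj]
  set R := ((Subalgebra.toSubmodule Y.opAlg).comap
    V.fockConj.toLinearMap).comap X.opAlgIncl.toLinearMap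
  have hcl : IsClosed (R : Set X.opAlg) :=
    ((Subalgebra.isClosed_topologicalClosure _).preimage
      V.isometry_fockConj.continuous).preimage X.opAlgIncl.continuous
  have htop : R = ⊤ := by
    refine X.eq_top_of_shiftAlg_mem hcl fun k ξ => ?_
    change V.fockConj (X.shift k ξ) ∈ Y.opAlg
    rw [← conj_eq_fockConj, conj_shift]
    exact Y.shift_mem_opAlg k _
  exact htop.ge (Submodule.mem_top (x := T))

theorem map_opAlg (V : Iso X Y) :
    X.opAlg.map V.fockConj.toAlgHom = Y.opAlg := by
  apply le_antisymm
  · rintro _ ⟨T, hT, rfl⟩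
    have := V.conj_mem_opAlg ⟨T, hT⟩
    rwa [conj_eq_fockConj] at this
  · intro T hT
    have := V.symm.conj_mem_opAlg ⟨T, hT⟩
    rw [conj_eq_fockConj] at this
    exact ⟨_, this, V.fockConj_fockConj_symm T⟩

/-- The isomorphism `T ↦ V T V*` of the operator algebras. -/
noncomputable def algEquiv (V : Iso X Y) : X.opAlg ≃ₐ[ℂ] Y.opAlg :=
  (V.fockConj.subalgebraMap X.opAlg).trans
    (Subalgebra.equivOfEq _ _ V.map_opAlg)

theorem coe_algEquiv (V : Iso X Y) (T : X.opAlg) : (V.algEquiv T : Y.FockOp) = V.conj T := by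
  rw [conj_eq_fockConj]
  rfl

theorem isometry_algEquiv (V : Iso X Y) : Isometry V.algEquiv := by
  refine AddMonoidHomClass.isometry_of_norm V.algEquiv fun T => ?_
  exact V.norm_fockConj T

theorem algEquiv_shiftAlg (V : Iso X Y) {n : ℕ} (ξ : X.Fiber n) :
    V.algEquiv (X.shiftAlg n ξ) = Y.shiftAlg n (V.map n ξ) :=
  Subtype.ext ((V.coe_algEquiv _).trans (V.conj_shift ξ))

/-- For `n = 0` this shows that `ker ρ₀` is preserved in both directions, as `V₀` is injective. -/
theorem coeff_algEquiv (V : Iso X Y) (n : ℕ) (T : X.opAlg) :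
    Y.coeff n (V.algEquiv T) = V.map n (X.coeff n T) := by
  have hc : (Y.coeff n).comp (toCLM V.algEquiv V.isometry_algEquiv) =
      ((V.map n).toContinuousLinearEquiv : X.Fiber n →L[ℂ] Y.Fiber n).comp (X.coeff n) := by
    refine X.continuousLinearMap_ext_shiftAlg fun k ξ => ?_
    change Y.coeff n (V.algEquiv (X.shiftAlg k ξ)) = V.map n (X.coeff n (X.shiftAlg k ξ))
    rw [algEquiv_shiftAlg]
    by_cases hk : n = k
    · subst hk
      rw [coeff_shiftAlg_self, coeff_shiftAlg_self]
    · rw [coeff_shiftAlg_ne _ hk, coeff_shiftAlg_ne _ hk, map_zero]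
  exact congrArg (fun f => f T) hc

theorem preservesGrading_algEquiv (V : Iso X Y) : PreservesGrading V.algEquiv := by
  intro n ξ
  rw [algEquiv_shiftAlg]
  exact Submodule.le_topologicalClosure _ (Submodule.subset_span ⟨V.map n ξ, rfl⟩)

theorem preservesDecomposition_algEquiv (V : Iso X Y) : PreservesDecomposition V.algEquiv := by
  constructor
  · rw [Submodule.map_span, Set.image_singleton]
    exact congrArg (fun T => Submodule.span ℂ {T}) (map_one V.algEquiv)
  · ext T
    rw [LinearMap.mem_ker, rho0_eq_zero_iff]
    constructor
    · rintro ⟨S, hS, rfl⟩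
      have hS' : X.coeff 0 S = 0 := (X.rho0_eq_zero_iff S).1 hS
      change Y.coeff 0 (V.algEquiv S) = 0
      rw [coeff_algEquiv, hS', map_zero]
    · intro hT
      refine ⟨V.algEquiv.symm T, ?_, V.algEquiv.apply_symm_apply T⟩
      refine (X.rho0_eq_zero_iff _).2 ((V.map 0).injective ?_)
      rw [← coeff_algEquiv, AlgEquiv.apply_symm_apply, hT, map_zero]

end Iso

/-- An isometric isomorphism that preserves the operators of each degree is implemented by an
isomorphism of subproduct systems. -/
theorem exists_iso_of_apply_shiftAlg_mem_range (hφ : Isometry φ)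
    (h : ∀ n ξ, φ (X.shiftAlg n ξ) ∈ Set.range (Y.shiftAlg n)) :
    ∃ V : Iso X Y, ∀ T : X.opAlg, ((φ T : Y.opAlg) : Y.FockOp) = V.conj (T : X.FockOp) := by
  refine ⟨isoOfAlgEquiv φ hφ h, fun T => ?_⟩
  set V := isoOfAlgEquiv φ hφ h
  -- Two continuous maps that agree on all shifts `S(ξ)` coincide on `𝒜_X`.
  have hc : toCLM φ hφ = toCLM V.algEquiv V.isometry_algEquiv := by
    refine X.continuousLinearMap_ext_shiftAlg fun n ξ => ?_
    change φ (X.shiftAlg n ξ) = V.algEquiv (X.shiftAlg n ξ)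
    rw [Iso.algEquiv_shiftAlg]
    exact (shiftAlg_fiberMap hφ h n ξ).symm
  rw [← Iso.coe_algEquiv]
  exact congrArg (fun f => ((f T : Y.opAlg) : Y.FockOp)) hc

theorem exists_iso_of_preserves (φ : X.opAlg ≃ₐ[ℂ] Y.opAlg) (hφ : Isometry φ)
    (h : PreservesDecomposition φ ∨ PreservesGrading φ) :
    ∃ V : Iso X Y, ∀ T : X.opAlg, ((φ T : Y.opAlg) : Y.FockOp) = V.conj (T : X.FockOp) :=
  exists_iso_of_apply_shiftAlg_mem_range hφ
    (h.elim (fun hd => hd.apply_shiftAlg_mem_range hφ) fun hg => hg.apply_shiftAlg_mem_range)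

end Implementation

end SubproductSystem

/-- Two subproduct systems of Hilbert spaces over `ℕ` are isomorphic if and only if their operator
algebras are isometrically isomorphic by a map that preserves `ℂ·I ⊕ ker ρ₀`, and if and only if
they are isometrically isomorphic by a grading preserving map; every such isomorphism is
`T ↦ V T V*` for an isomorphism `V : X → Y`. -/
theorem mainTheorem7 (X : SubproductSystem.{u}) (Y : SubproductSystem.{v}) :
    (Nonempty (SubproductSystem.Iso X Y) ↔
      ∃ φ : X.opAlg ≃ₐ[ℂ] Y.opAlg,
        Isometry φ ∧ SubproductSystem.PreservesDecomposition φ) ∧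
    (Nonempty (SubproductSystem.Iso X Y) ↔
      ∃ φ : X.opAlg ≃ₐ[ℂ] Y.opAlg,
        Isometry φ ∧ SubproductSystem.PreservesGrading φ) ∧
    (∀ φ : X.opAlg ≃ₐ[ℂ] Y.opAlg, Isometry φ →
      (SubproductSystem.PreservesDecomposition φ ∨ SubproductSystem.PreservesGrading φ) →
      ∃ V : SubproductSystem.Iso X Y,
        ∀ T : X.opAlg, ((φ T : Y.opAlg) : Y.FockOp) = V.conj (T : X.FockOp)) := by
  refine ⟨⟨?_, ?_⟩, ⟨?_, ?_⟩, SubproductSystem.exists_iso_of_preserves⟩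
  · rintro ⟨V⟩
    exact ⟨V.algEquiv, V.isometry_algEquiv, V.preservesDecomposition_algEquiv⟩
  · rintro ⟨φ, hφ, h⟩
    exact ⟨(SubproductSystem.exists_iso_of_preserves φ hφ (Or.inl h)).choose⟩
  · rintro ⟨V⟩
    exact ⟨V.algEquiv, V.isometry_algEquiv, V.preservesGrading_algEquiv⟩
  · rintro ⟨φ, hφ, h⟩
    exact ⟨(SubproductSystem.exists_iso_of_preserves φ hφ (Or.inr h)).choose⟩
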